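/- Let a base station be at the origin of $\mathbb R^2$, and let $R>0$, $\lambda>0$, $\alpha>2$, $\sigma^2\ge 0$, $\beta_0>0$. A cellular user is uniformly distributed in the closed disk of radius $R$ centred at the origin; let $d_{0,0}$ be its distance from the origin, $p_0\ge 0$ its random transmit power and $h_{0,0}\sim\mathcal{CN}(0,1)$ its fading coefficient. The D2D transmitters are the points $(x_k)_{k\ge1}$ of a homogeneous Poisson point process $\Phi$ of density $\lambda$ on $\mathbb R^2$; they have i.i.d. transmit powers $p_k\ge 0$ with $\mathbb E[p_k^{2/\alpha}]<\infty$ and i.i.d. fading coefficients $h_{0,k}\sim\mathcal{CN}(0,1)$ to the base station. The user's location, $p_0$, $h_{0,0}$, the sequence $(x_k)_k$, all the $p_k$ and all the $h_{0,k}$ are mutually independent. Put $$\mathrm{SINR}_0=\frac{p_0|h_{0,0}|^2d_{0,0}^{-\alpha}}{\sum_{k\ge1}p_k|h_{0,k}|^2\|x_k\|^{-\alpha}+\sigma^2}\in[0,\infty],\qquad X=p_0^{-1}d_{0,0}^{\alpha}\in[0,\infty],$$ where $X=\infty$ if $p_0=0$, and $c/0=\infty$ for $c>0$, $0/0=0$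 in the definition of $\mathrm{SINR}_0$. Then the uplink coverage probability $\bar P^{(C)}_{\mathrm{cov}}(\beta_0)=\mathbb P(\mathrm{SINR}_0\ge\beta_0)$ is $$\bar P^{(C)}_{\mathrm{cov}}(\beta_0)=\mathbb E_X\left[e^{-a_1X-a_2X^{2/\alpha}}\right],\qquad a_1=\sigma^2\beta_0,\quad a_2=\frac{\pi\lambda\beta_0^{2/\alpha}}{\mathrm{sinc}(2/\alpha)}\,\mathbb E\left[p_k^{2/\alpha}\right],$$ where $\mathrm{sinc}(t)=\frac{\sin(\pi t)}{\pi t}$ and the exponential is read as $0$ where $X=\infty$. Moreover, the distribution function of $d_{0,0}$ is $$F_{d_{0,0}}(r)=\begin{cases}0,&r<0,\\ r^2/R^2,&0\le r\le R,\\ 1,&r>R,\end{cases}$$ and $X$ has the distribution function $$F_X(x)=\int F_{d_{0,0}}\left(x^{1/\alpha}p^{1/\alpha}\right)\,\mathrm dF_{p_0}(p),\qquad x\ge 0,$$ where $F_{p_0}$ is the distribution function of $p_0$. -/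

import Mathlib

open MeasureTheory ProbabilityTheory
open scoped ENNReal NNReal

noncomputable section

namespace D2D

/-- The Euclidean plane. -/
abbrev Plane : Type := EuclideanSpace ℝ (Fin 2)

/-- The circularly symmetric complex Gaussian law `CN(0, v)`: the real and the imaginary part are
independent centred real Gaussians of variance `v / 2`. -/
def complexGaussian (v : ℝ≥0) : Measure ℂ :=
  ((gaussianReal 0 (v / 2)).prod (gaussianReal 0 (v / 2))).map Complex.measurableEquivRealProd.symm

/-- The random counting measure `∑ₖ δ_{xₖ}` of a sequence of random points. -/
def countingMeasure {Ω E : Type*} [MeasurableSpace E] (x : ℕ → Ω → E) (ω : Ω) : Measure E :=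
  Measure.sum fun k => Measure.dirac (x k ω)

/-- The random points `x₀, x₁, …` form a Poisson point process with intensity measure `Λ`: the
number of points in a measurable set `A` with `Λ A < ∞` is Poisson with mean `Λ A`, and the numbers
of points in finitely many pairwise disjoint measurable sets are independent. -/
structure IsPoissonProcess {Ω E : Type*} [MeasurableSpace Ω] [MeasurableSpace E]
    (x : ℕ → Ω → E) (Λ : Measure E) (μ : Measure Ω) : Prop where
  count_law : ∀ A : Set E, MeasurableSet A → Λ A ≠ ∞ →
    μ.map (fun ω => countingMeasure x ω A) =
      (poissonMeasure (Λ A).toNNReal).map (fun n : ℕ => (n : ℝ≥0∞))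
  count_indep : ∀ (n : ℕ) (A : Fin n → Set E), (∀ i, MeasurableSet (A i)) →
    Pairwise (fun i j => Disjoint (A i) (A j)) →
    iIndepFun (fun i ω => countingMeasure x ω (A i)) μ

/-- The random quantities that determine the uplink reception at the base station, which is at the
origin. The D2D transmitters are enumerated by `ℕ` (a homogeneous Poisson process of positive
density has infinitely many points almost surely). -/
structure Network (Ω : Type*) where
  /-- location of the cellular user -/
  user : Ω → Plane
  /-- transmit power `p₀` of the cellular user -/
  userPower : Ω → ℝ
  /-- fading coefficient `h₀₀` from the cellular user to the base station -/
  userFading : Ω → ℂ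
  /-- locations of the D2D transmitters -/
  tx : ℕ → Ω → Plane
  /-- transmit powers of the D2D transmitters -/
  txPower : ℕ → Ω → ℝ
  /-- fading coefficients from the D2D transmitters to the base station -/
  txFading : ℕ → Ω → ℂ

/-- Labels of the independent sources of randomness. The locations of all the D2D transmitters
together are one source; each power and each fading coefficient is a source of its own. -/
inductive Source : Type
  | user
  | userPower
  | userFading
  | tx
  | txPower (k : ℕ)
  | txFading (k : ℕ)

namespace Network

variable {Ω : Type*}

/-- The σ-algebra generated by a source. -/
@[reducible] def sigma (N : Network Ω) : Source → MeasurableSpace Ω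
  | .user => MeasurableSpace.comap N.user inferInstance
  | .userPower => MeasurableSpace.comap N.userPower inferInstance
  | .userFading => MeasurableSpace.comap N.userFading inferInstance
  | .tx => MeasurableSpace.comap (fun ω k => N.tx k ω) inferInstance
  | .txPower k => MeasurableSpace.comap (N.txPower k) inferInstance
  | .txFading k => MeasurableSpace.comap (N.txFading k) inferInstance

/-- The probabilistic assumptions: cellular user uniform in the disk of radius `R`, D2D transmitters
a homogeneous Poisson process of density `lam` in the plane, i.i.d. D2D powers, Rayleigh fading, and
independence of all the sources of randomness. -/
structure IsModel [MeasurableSpace Ω] (N : Network Ω) (R lam : ℝ) (μ : Measure Ω) : Prop where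
  measurable_user : Measurable N.user
  measurable_userPower : Measurable N.userPower
  measurable_userFading : Measurable N.userFading
  measurable_tx : ∀ k, Measurable (N.tx k)
  measurable_txPower : ∀ k, Measurable (N.txPower k)
  measurable_txFading : ∀ k, Measurable (N.txFading k)
  user_uniform : pdf.IsUniform N.user (Metric.closedBall 0 R) μ volume
  userPower_nonneg : ∀ᵐ ω ∂μ, 0 ≤ N.userPower ω
  userFading_law : μ.map N.userFading = complexGaussian 1
  tx_poisson : IsPoissonProcess N.tx (ENNReal.ofReal lam • volume) μ
  txPower_nonneg : ∀ k, ∀ᵐ ω ∂μ, 0 ≤ N.txPower k ω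
  txPower_identDistrib : ∀ k, IdentDistrib (N.txPower k) (N.txPower 0) μ μ
  txFading_law : ∀ k, μ.map (N.txFading k) = complexGaussian 1
  indep : iIndep N.sigma μ

/-- Power received at the origin from a transmitter at `z` with transmit power `p` and fading
coefficient `h`, namely `p |h|² ‖z‖^(-α)`, as an extended nonnegative number. -/
def received (α : ℝ) (p : ℝ) (h : ℂ) (z : Plane) : ℝ≥0∞ :=
  ENNReal.ofReal p * ‖h‖ₑ ^ 2 * ‖z‖ₑ ^ (-α)

/-- Total D2D interference at the base station. -/
def interference (N : Network Ω) (α : ℝ) (ω : Ω) : ℝ≥0∞ :=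
  ∑' k, received α (N.txPower k ω) (N.txFading k ω) (N.tx k ω)

/-- The SINR of the uplink with noise power `σ²`. -/
def sinr (N : Network Ω) (α σ : ℝ) (ω : Ω) : ℝ≥0∞ :=
  received α (N.userPower ω) (N.userFading ω) (N.user ω) /
    (N.interference α ω + ENNReal.ofReal (σ ^ 2))

/-- The uplink coverage probability at the SINR threshold `β₀`. -/
def coverage [MeasurableSpace Ω] (N : Network Ω) (α σ : ℝ) (μ : Measure Ω) (β₀ : ℝ) : ℝ :=
  μ.real {ω | ENNReal.ofReal β₀ ≤ N.sinr α σ ω}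

/-- `X = p₀⁻¹ d₀₀^α`, equal to `∞` where the cellular user is silent (`p₀ = 0`). -/
def X (N : Network Ω) (α : ℝ) (ω : Ω) : ℝ≥0∞ :=
  (ENNReal.ofReal (N.userPower ω))⁻¹ * ‖N.user ω‖ₑ ^ α

end Network

/-- `exp (-a₁ x - a₂ x^(2/α))`, with `e^(-∞) = 0` at `x = ∞`. -/
def expTerm (α a₁ a₂ : ℝ) (x : ℝ≥0∞) : ℝ :=
  if x = ∞ then 0 else Real.exp (-a₁ * x.toReal - a₂ * x.toReal ^ (2 / α))

/-- The distribution function of the distance from the centre of a uniform point in a disk of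
radius `R`. -/
def distanceCDF (R r : ℝ) : ℝ :=
  if r < 0 then 0 else if r ≤ R then r ^ 2 / R ^ 2 else 1

end D2D

end

/-! Since `|h₀₀|²` is standard exponential, coverage given `X` and the interference `I` has
probability `e^(-β₀ (I + σ²) X)` (`IsModel.measure_le_sinr`). As `X` and `I` are independent, the
noise contributes `e^(-a₁ X)` and the interference its Laplace transform at `s = β₀ X`.

For that transform, fix the locations first: the marks are independent, so it is a product `∏
L(xₖ)`, where `L(z)` is the transform of one received power. Written as `exp (-∑ -log L(xₖ))`, it is
averaged over the locations by the Laplace functional of the Poisson process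
(`IsPoissonProcess.lintegral_expNeg_tsum`), which gives `exp (-λ ∫ (1 - L))`. In the remaining
integral, `1 - e^(-t)` is the probability that an auxiliary exponential variable is below `t`;
Tonelli turns the integral into a mean disk area, proportional to `s^(2/α)`. The two Gamma factors,
from the auxiliary variable and from the fading, combine to `1 / sinc` by Euler's reflection
formula.

The distribution functions come from a ratio of areas and from conditioning on `p₀`. Working in `[0,
∞]` with `e^(-∞) = 0` avoids proving that the interference is almost surely finite. -/

noncomputable section

namespace D2D

/-! ### Exponential and logarithm on `[0, ∞]`; the Poisson law. -/

/-- The function `e^(-x)` on `[0, ∞]`, with `e^(-∞) = 0`. -/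
def expNeg (x : ℝ≥0∞) : ℝ≥0∞ := EReal.exp (-(x : EReal))

@[simp] lemma expNeg_zero : expNeg 0 = 1 := by simp [expNeg]

@[simp] lemma expNeg_top : expNeg ∞ = 0 := by simp [expNeg]

lemma expNeg_add (x y : ℝ≥0∞) : expNeg (x + y) = expNeg x * expNeg y := by
  rw [expNeg, expNeg, expNeg, ← EReal.exp_add, EReal.coe_ennreal_add, EReal.neg_add]
  · rfl
  · left; simp
  · right; simp

lemma expNeg_sum {ι : Type*} (s : Finset ι) (f : ι → ℝ≥0∞) :
    expNeg (∑ i ∈ s, f i) = ∏ i ∈ s, expNeg (f i) := by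
  classical
  induction s using Finset.induction_on with
  | empty => simp
  | insert a s ha ih => rw [Finset.sum_insert ha, Finset.prod_insert ha, expNeg_add, ih]

lemma expNeg_nsmul (n : ℕ) (x : ℝ≥0∞) : expNeg (x * n) = expNeg x ^ n := by
  have := expNeg_sum (Finset.range n) fun _ => x
  simpa [mul_comm] using this

lemma antitone_expNeg : Antitone expNeg := fun _ _ h =>
  EReal.exp_monotone (EReal.neg_le_neg_iff.2 (EReal.coe_ennreal_le_coe_ennreal_iff.2 h))

lemma expNeg_le_one (x : ℝ≥0∞) : expNeg x ≤ 1 := by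
  simpa using antitone_expNeg (zero_le : 0 ≤ x)

lemma expNeg_ne_top (x : ℝ≥0∞) : expNeg x ≠ ∞ :=
  ((expNeg_le_one x).trans_lt ENNReal.one_lt_top).ne

lemma continuous_expNeg : Continuous expNeg :=
  ENNReal.continuous_exp.comp (continuous_neg.comp continuous_coe_ennreal_ereal)

@[fun_prop] lemma measurable_expNeg : Measurable expNeg := continuous_expNeg.measurable

lemma expNeg_ofReal {x : ℝ} (hx : 0 ≤ x) :
    expNeg (ENNReal.ofReal x) = ENNReal.ofReal (Real.exp (-x)) := by
  rw [expNeg, EReal.coe_ennreal_ofReal, max_eq_left hx, ← EReal.coe_neg, EReal.exp_coe]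

lemma expNeg_of_ne_top {x : ℝ≥0∞} (hx : x ≠ ∞) :
    expNeg x = ENNReal.ofReal (Real.exp (-x.toReal)) := by
  rw [← expNeg_ofReal ENNReal.toReal_nonneg, ENNReal.ofReal_toReal hx]

/-- The function `-log x`, truncated to `[0, ∞]`. -/
def negLog (x : ℝ≥0∞) : ℝ≥0∞ := (-ENNReal.log x).toENNReal

/-- For `x ≤ 1` the truncation in `negLog` loses nothing, and `x = 0` passes through `∞`. This turns
a product of Laplace transforms into the exponential of a sum over the points. -/
lemma expNeg_negLog {x : ℝ≥0∞} (hx : x ≤ 1) : expNeg (negLog x) = x := by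
  rw [expNeg, negLog, EReal.coe_toENNReal, neg_neg, ENNReal.exp_log]
  simpa [EReal.neg_nonneg] using hx

@[fun_prop] lemma measurable_negLog : Measurable negLog := by
  unfold negLog; fun_prop

/-- The Laplace transform of the Poisson law. -/
lemma lintegral_expNeg_poisson (r : ℝ≥0) (c : ℝ≥0∞) :
    ∫⁻ n : ℕ, expNeg (c * n) ∂(poissonMeasure r) = expNeg ((1 - expNeg c) * r) := by
  obtain ⟨q, hq⟩ : ∃ q : ℝ≥0, expNeg c = q := ⟨_, (ENNReal.coe_toNNReal (expNeg_ne_top c)).symm⟩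
  have hq1 : q ≤ 1 := by have := expNeg_le_one c; rw [hq] at this; exact_mod_cast this
  have hsum : HasSum (fun n : ℕ => Real.exp (-r) * r ^ n / n.factorial * q ^ n)
      (Real.exp (-r) * Real.exp (r * q)) := by
    have h := (NormedSpace.expSeries_div_hasSum_exp ((r : ℝ) * q)).mul_left (Real.exp (-r))
    rw [← Real.exp_eq_exp_ℝ] at h
    refine h.congr_fun ?_
    intro n
    rw [mul_pow]; ring
  simp_rw [expNeg_nsmul, hq]
  rw [poissonMeasure, lintegral_sum_measure]
  simp_rw [lintegral_smul_measure, lintegral_dirac, smul_eq_mul]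
  have : ∀ n : ℕ, ENNReal.ofReal (Real.exp (-r) * r ^ n / n.factorial) * (q : ℝ≥0∞) ^ n =
      ENNReal.ofReal (Real.exp (-r) * r ^ n / n.factorial * q ^ n) := by
    intro n
    rw [ENNReal.ofReal_mul (by positivity), ENNReal.ofReal_pow (by positivity),
      ENNReal.ofReal_coe_nnreal]
  simp_rw [this]
  rw [← ENNReal.ofReal_tsum_of_nonneg (fun n => by positivity) hsum.summable, hsum.tsum_eq,
    expNeg_of_ne_top (by finiteness), ← Real.exp_add]
  congr 2
  rw [ENNReal.toReal_mul, ENNReal.toReal_sub_of_le (by exact_mod_cast hq1) (by simp)]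
  simp
  ring

/-! ### The Laplace functional of a Poisson process. -/

section Laplace

variable {Ω E : Type*} [MeasurableSpace Ω] [MeasurableSpace E]

lemma lintegral_countingMeasure {Ω : Type*} (x : ℕ → Ω → E) (ω : Ω) {f : E → ℝ≥0∞}
    (hf : Measurable f) :
    ∫⁻ z, f z ∂(countingMeasure x ω) = ∑' k, f (x k ω) := by
  rw [countingMeasure, lintegral_sum_measure]
  simp_rw [lintegral_dirac' _ hf]

lemma measurable_countingMeasure_apply {x : ℕ → Ω → E} (hx : ∀ k, Measurable (x k)) {A : Set E}
    (hA : MeasurableSet A) : Measurable fun ω => countingMeasure x ω A := by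
  simp_rw [countingMeasure, Measure.sum_apply _ hA, Measure.dirac_apply' _ hA]
  exact Measurable.tsum fun k => (measurable_one.indicator hA).comp (hx k)

variable {x : ℕ → Ω → E} {Λ : Measure E} {μ : Measure Ω}

lemma IsPoissonProcess.lintegral_expNeg_count (h : IsPoissonProcess x Λ μ)
    (hx : ∀ k, Measurable (x k)) {A : Set E} (hA : MeasurableSet A) (hΛ : Λ A ≠ ∞) (c : ℝ≥0∞) :
    ∫⁻ ω, expNeg (c * countingMeasure x ω A) ∂μ = expNeg ((1 - expNeg c) * Λ A) := by
  have hm := measurable_countingMeasure_apply hx hA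
  rw [← lintegral_map (f := fun t => expNeg (c * t)) (by fun_prop) hm, h.count_law A hA hΛ,
    lintegral_map (by fun_prop) .of_discrete, lintegral_expNeg_poisson, ENNReal.coe_toNNReal hΛ]

/-- The fibres over distinct values are disjoint, so their counts are independent and the
expectation factorises into Poisson transforms. The value `0` is dropped: it contributes nothing to
either integral, and its fibre may have infinite measure. -/
lemma IsPoissonProcess.lintegral_expNeg_simpleFunc (h : IsPoissonProcess x Λ μ)
    (hx : ∀ k, Measurable (x k)) (f : SimpleFunc E ℝ≥0∞)
    (hf : ∀ c, c ≠ 0 → Λ (f ⁻¹' {c}) ≠ ∞) :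
    ∫⁻ ω, expNeg (∫⁻ z, f z ∂(countingMeasure x ω)) ∂μ =
      expNeg (∫⁻ z, (1 - expNeg (f z)) ∂Λ) := by
  classical
  set s := f.range.filter (· ≠ 0) with hs
  let e := s.equivFin
  have hI : iIndepFun
      (fun (i : Fin s.card) ω => countingMeasure x ω (f ⁻¹' {((e.symm i : s) : ℝ≥0∞)})) μ := by
    refine h.count_indep _ _ (fun i => f.measurableSet_fiber _) ?_
    intro i j hij
    refine Disjoint.preimage _ ?_
    simpa [Subtype.ext_iff] using fun h => hij (e.symm.injective (Subtype.ext h))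
  have hL : ∀ ω, ∫⁻ z, f z ∂(countingMeasure x ω) =
      ∑ i : Fin s.card, (e.symm i : ℝ≥0∞) * countingMeasure x ω (f ⁻¹' {(e.symm i : ℝ≥0∞)}) := by
    intro ω
    rw [SimpleFunc.lintegral_eq_lintegral, SimpleFunc.lintegral,
      Equiv.sum_comp e.symm (fun c : s => (c : ℝ≥0∞) * countingMeasure x ω (f ⁻¹' {(c : ℝ≥0∞)})),
      Finset.sum_coe_sort s (fun c => c * countingMeasure x ω (f ⁻¹' {c})), hs, Finset.sum_filter]
    refine Finset.sum_congr rfl fun c _ => ?_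
    by_cases hc : c = 0 <;> simp [hc]
  have hR : ∫⁻ z, (1 - expNeg (f z)) ∂Λ =
      ∑ i : Fin s.card, (1 - expNeg (e.symm i)) * Λ (f ⁻¹' {(e.symm i : ℝ≥0∞)}) := by
    have := SimpleFunc.lintegral_eq_lintegral (f.map fun c => 1 - expNeg c) Λ
    rw [SimpleFunc.map_lintegral] at this
    simp only [SimpleFunc.map_apply] at this
    rw [this, Equiv.sum_comp e.symm (fun c : s => (1 - expNeg c) * Λ (f ⁻¹' {(c : ℝ≥0∞)})),
      Finset.sum_coe_sort s (fun c => (1 - expNeg c) * Λ (f ⁻¹' {c})), hs, Finset.sum_filter]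
    refine Finset.sum_congr rfl fun c _ => ?_
    by_cases hc : c = 0 <;> simp [hc]
  have hm : ∀ i, Measurable fun ω => countingMeasure x ω (f ⁻¹' {((e.symm i : s) : ℝ≥0∞)}) :=
    fun i => measurable_countingMeasure_apply hx (f.measurableSet_fiber _)
  simp_rw [hL, hR, expNeg_sum]
  refine (lintegral_prod_eq_prod_lintegral_of_indepFun Finset.univ _
    (hI.comp (fun i t => expNeg ((e.symm i : ℝ≥0∞) * t)) (fun i => by fun_prop))
    (fun i => by have := hm i; simp only [Function.comp_def]; fun_prop)).trans ?_
  refine Finset.prod_congr rfl fun i _ => ?_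
  exact h.lintegral_expNeg_count hx (f.measurableSet_fiber _)
    (hf _ (Finset.mem_filter.1 (e.symm i).2).2) _

/-- The Laplace functional of a Poisson process. -/
theorem IsPoissonProcess.lintegral_expNeg_tsum [SigmaFinite Λ] [IsFiniteMeasure μ]
    (h : IsPoissonProcess x Λ μ) (hx : ∀ k, Measurable (x k)) {f : E → ℝ≥0∞} (hf : Measurable f) :
    ∫⁻ ω, expNeg (∑' k, f (x k ω)) ∂μ = expNeg (∫⁻ z, (1 - expNeg (f z)) ∂Λ) := by
  -- Cutting off to the spanning sets gives every nonzero value a fibre of finite intensity.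
  let F : ℕ → SimpleFunc E ℝ≥0∞ := fun n => (SimpleFunc.eapprox f n).restrict (spanningSets Λ n)
  have hFa : ∀ n z, F n z = (spanningSets Λ n).indicator (SimpleFunc.eapprox f n) z := fun n z =>
    SimpleFunc.restrict_apply _ (measurableSet_spanningSets Λ n) z
  have hmono : ∀ z, Monotone fun n => F n z := by
    intro z m n hmn
    simp only [hFa]
    refine (Set.indicator_le_indicator (SimpleFunc.monotone_eapprox f hmn z)).trans ?_
    exact Set.indicator_le_indicator_of_subset (monotone_spanningSets Λ hmn) (fun _ => zero_le) z
  have hlim : ∀ z, Filter.Tendsto (fun n => F n z) Filter.atTop (nhds (f z)) := by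
    intro z
    have h1 := SimpleFunc.tendsto_eapprox hf z
    refine h1.congr' ?_
    filter_upwards [Filter.eventually_ge_atTop (spanningSetsIndex Λ z)] with n hn
    rw [hFa, Set.indicator_of_mem]
    exact monotone_spanningSets Λ hn (mem_spanningSetsIndex Λ z)
  have hfin : ∀ n c, c ≠ 0 → Λ (F n ⁻¹' {c}) ≠ ∞ := by
    intro n c hc
    rw [SimpleFunc.restrict_preimage_singleton _ (measurableSet_spanningSets Λ n) hc]
    exact ((measure_mono Set.inter_subset_left).trans_lt (measure_spanningSets_lt_top Λ n)).ne
  have key := fun n => h.lintegral_expNeg_simpleFunc hx (F n) (hfin n)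
  have hleft : Filter.Tendsto (fun n => ∫⁻ ω, expNeg (∫⁻ z, F n z ∂(countingMeasure x ω)) ∂μ)
      Filter.atTop (nhds (∫⁻ ω, expNeg (∫⁻ z, f z ∂(countingMeasure x ω)) ∂μ)) := by
    -- Monotone convergence inside the exponential, dominated convergence by `1` outside.
    refine tendsto_lintegral_of_dominated_convergence (fun _ => 1) (fun n => ?_)
      (fun n => ae_of_all _ fun ω => expNeg_le_one _) (by simp) (ae_of_all _ fun ω => ?_)
    · simp_rw [lintegral_countingMeasure x _ (F n).measurable]
      exact measurable_expNeg.comp (Measurable.tsum fun k => (F n).measurable.comp (hx k))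
    · refine (continuous_expNeg.tendsto _).comp ?_
      exact lintegral_tendsto_of_tendsto_of_monotone (fun n => (F n).measurable.aemeasurable)
        (ae_of_all _ hmono) (ae_of_all _ hlim)
  have hright : Filter.Tendsto (fun n => expNeg (∫⁻ z, (1 - expNeg (F n z)) ∂Λ))
      Filter.atTop (nhds (expNeg (∫⁻ z, (1 - expNeg (f z)) ∂Λ))) := by
    refine (continuous_expNeg.tendsto _).comp ?_
    refine lintegral_tendsto_of_tendsto_of_monotone (fun n => ?_)
      (ae_of_all _ fun z m n hmn => tsub_le_tsub_left (antitone_expNeg (hmono z hmn)) 1)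
      (ae_of_all _ fun z => ?_)
    · have := (F n).measurable
      fun_prop
    · exact ENNReal.Tendsto.sub tendsto_const_nhds ((continuous_expNeg.tendsto _).comp (hlim z))
        (.inl ENNReal.one_ne_top)
  simp_rw [← lintegral_countingMeasure x _ hf]
  exact tendsto_nhds_unique hleft (by simpa only [key] using hright)

end Laplace

/-! ### Rayleigh fading: the squared modulus is exponential. -/

instance : IsProbabilityMeasure (complexGaussian 1) :=
  Measure.isProbabilityMeasure_map (MeasurableEquiv.measurable _).aemeasurable

/-- The squared modulus of a standard complex Gaussian variable has density `e^(-t)`. -/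
lemma lintegral_complexGaussian_norm_sq {G : ℝ → ℝ≥0∞} (hG : Measurable G) :
    ∫⁻ h, G (‖h‖ ^ 2) ∂(complexGaussian 1) =
      ∫⁻ t in Set.Ioi (0 : ℝ), ENNReal.ofReal (Real.exp (-t)) * G t := by
  have hv : (1 / 2 : ℝ≥0) ≠ 0 := by norm_num
  have h1 : ∫⁻ h, G (‖h‖ ^ 2) ∂(complexGaussian 1) =
      ∫⁻ p : ℝ × ℝ, ENNReal.ofReal (Real.pi⁻¹ * Real.exp (-(p.1 ^ 2 + p.2 ^ 2))) *
        G (p.1 ^ 2 + p.2 ^ 2) := by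
    rw [complexGaussian, lintegral_map (by fun_prop) (MeasurableEquiv.measurable _),
      gaussianReal_of_var_ne_zero _ hv,
      prod_withDensity (measurable_gaussianPDF _ _) (measurable_gaussianPDF _ _),
      ← Measure.volume_eq_prod, lintegral_withDensity_eq_lintegral_mul _
        (by fun_prop) (by fun_prop)]
    refine lintegral_congr fun p => ?_
    simp only [Pi.mul_apply, gaussianPDF]
    rw [← ENNReal.ofReal_mul (gaussianPDFReal_nonneg _ _ _)]
    congr 2
    · simp only [gaussianPDFReal]
      rw [mul_mul_mul_comm, ← Real.exp_add, ← mul_inv, Real.mul_self_sqrt (by positivity)]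
      congr 2
      · push_cast; ring
      · push_cast; ring
    · rw [Complex.sq_norm, Complex.normSq_apply]
      simp [Complex.measurableEquivRealProd]
      ring
  have h2 : ∀ p ∈ polarCoord.target, ENNReal.ofReal p.1 * (ENNReal.ofReal (Real.pi⁻¹ *
        Real.exp (-((polarCoord.symm p).1 ^ 2 + (polarCoord.symm p).2 ^ 2))) *
        G ((polarCoord.symm p).1 ^ 2 + (polarCoord.symm p).2 ^ 2)) =
      ENNReal.ofReal (p.1 * (Real.pi⁻¹ * Real.exp (-p.1 ^ 2))) * G (p.1 ^ 2) := by
    intro p hp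
    have hp0 : 0 < p.1 := hp.1
    have : (polarCoord.symm p).1 ^ 2 + (polarCoord.symm p).2 ^ 2 = p.1 ^ 2 := by
      simp only [polarCoord_symm_apply]
      linear_combination p.1 ^ 2 * Real.sin_sq_add_cos_sq p.2
    rw [this, ENNReal.ofReal_mul hp0.le, mul_assoc]
  -- The angle integrates to `2π`, leaving the density `2 r e^(-r²)`, which the substitution `t =
  -- r²` turns into `e^(-t)`.
  rw [h1, ← lintegral_comp_polarCoord_symm]
  simp only [smul_eq_mul]
  rw [setLIntegral_congr_fun polarCoord.open_target.measurableSet h2, polarCoord_target,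
    Measure.volume_eq_prod, ← Measure.prod_restrict, lintegral_prod _ (by fun_prop)]
  simp only [lintegral_const, Measure.restrict_apply_univ, Real.volume_Ioo]
  have himg : (fun r : ℝ => r ^ 2) '' Set.Ioi 0 = Set.Ioi 0 := by
    ext t
    constructor
    · rintro ⟨r, hr, rfl⟩
      exact pow_pos (Set.mem_Ioi.1 hr) 2
    · intro ht
      exact ⟨√t, Real.sqrt_pos.2 ht, Real.sq_sqrt (le_of_lt ht)⟩
  have hinj : Set.InjOn (fun r : ℝ => r ^ 2) (Set.Ioi 0) := fun a ha b hb hab =>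
    (pow_left_inj₀ (le_of_lt ha) (le_of_lt hb) two_ne_zero).1 hab
  conv_rhs => rw [← himg, lintegral_image_eq_lintegral_abs_deriv_mul measurableSet_Ioi
    (fun r _ => (hasDerivAt_pow 2 r).hasDerivWithinAt) hinj]
  refine setLIntegral_congr_fun measurableSet_Ioi fun r hr => ?_
  have hr0 : 0 < r := hr
  rw [← mul_assoc (ENNReal.ofReal |_|), ← ENNReal.ofReal_mul (abs_nonneg _), mul_right_comm,
    ← ENNReal.ofReal_mul (by positivity), abs_of_nonneg (by positivity)]
  congr 2
  have := Real.pi_ne_zero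
  field_simp
  ring

lemma enorm_sq_eq (h : ℂ) : ‖h‖ₑ ^ 2 = ENNReal.ofReal (‖h‖ ^ 2) := by
  rw [ENNReal.ofReal_pow (norm_nonneg _), ofReal_norm]

lemma complexGaussian_tail (t : ℝ≥0∞) : complexGaussian 1 {h | t ≤ ‖h‖ₑ ^ 2} = expNeg t := by
  rcases eq_or_ne t ∞ with rfl | ht
  · simp
  have hm : MeasurableSet {h : ℂ | t ≤ ‖h‖ₑ ^ 2} := measurableSet_le (by fun_prop) (by fun_prop)
  have h1 : complexGaussian 1 {h | t ≤ ‖h‖ₑ ^ 2} =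
      ∫⁻ h, (Set.Ici t.toReal).indicator 1 (‖h‖ ^ 2) ∂(complexGaussian 1) := by
    rw [← lintegral_indicator_one hm]
    refine lintegral_congr fun h => ?_
    simp only [Set.indicator, Set.mem_ofPred_eq, Set.mem_Ici, enorm_sq_eq, Pi.one_apply]
    congr 1
    rw [ENNReal.le_ofReal_iff_toReal_le ht (by positivity)]
  rw [h1, lintegral_complexGaussian_norm_sq (measurable_one.indicator measurableSet_Ici),
    expNeg_of_ne_top ht]
  have h2 : ∀ s : ℝ, ENNReal.ofReal (Real.exp (-s)) * (Set.Ici t.toReal).indicator 1 s =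
      (Set.Ici t.toReal).indicator (fun s => ENNReal.ofReal (Real.exp (-s))) s := by
    intro s
    by_cases hs : s ∈ Set.Ici t.toReal <;> simp [hs]
  simp_rw [h2]
  rw [setLIntegral_indicator measurableSet_Ici]
  have h3 : (Set.Ici t.toReal ∩ Set.Ioi 0 : Set ℝ) =ᵐ[volume] Set.Ioi t.toReal := by
    have ha : (Set.Ici t.toReal : Set ℝ) =ᵐ[volume] Set.Ioi t.toReal := Ioi_ae_eq_Ici.symm
    refine (ha.inter (Filter.EventuallyEq.rfl)).trans (Filter.EventuallyEq.of_eq ?_)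
    exact Set.inter_eq_left.2 (Set.Ioi_subset_Ioi ENNReal.toReal_nonneg)
  rw [setLIntegral_congr h3, ← ofReal_integral_eq_lintegral_ofReal
    (integrableOn_exp_neg_Ioi _) (ae_of_all _ fun _ => (Real.exp_pos _).le),
    integral_exp_neg_Ioi]

/-- Reading `1 - e^(-t)` as a probability lets Tonelli replace an integral over the plane by the
area of a disk. -/
lemma one_sub_expNeg (t : ℝ≥0∞) :
    1 - expNeg t = complexGaussian 1 {h | ‖h‖ₑ ^ 2 < t} := by
  have hm : MeasurableSet {h : ℂ | t ≤ ‖h‖ₑ ^ 2} := measurableSet_le (by fun_prop) (by fun_prop)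
  rw [← complexGaussian_tail, ← prob_compl_eq_one_sub hm]
  congr 1
  ext h
  simp

lemma lintegral_complexGaussian_rpow {a : ℝ} (ha : -1 < a) :
    ∫⁻ h, (‖h‖ₑ ^ 2) ^ a ∂(complexGaussian 1) = ENNReal.ofReal (Real.Gamma (1 + a)) := by
  simp_rw [enorm_sq_eq]
  rw [lintegral_complexGaussian_norm_sq (G := fun t => ENNReal.ofReal t ^ a) (by fun_prop),
    Real.Gamma_eq_integral (by linarith), ofReal_integral_eq_lintegral_ofReal
      (Real.GammaIntegral_convergent (by linarith))]
  · refine setLIntegral_congr_fun measurableSet_Ioi fun t ht => ?_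
    rw [ENNReal.ofReal_rpow_of_pos ht, ← ENNReal.ofReal_mul (Real.exp_pos _).le,
      add_sub_cancel_left]
  · filter_upwards [ae_restrict_mem measurableSet_Ioi] with t ht
    have : (0 : ℝ) < t := ht
    positivity

/-- The origin lies in every event `|h|² < 1 / (n + 1)`, of probability `1 - e^(-1/(n+1)) → 0`. -/
lemma complexGaussian_ae_ne_zero : ∀ᵐ h ∂(complexGaussian 1), h ≠ 0 := by
  have h1 : ∀ n : ℕ, complexGaussian 1 {0} ≤ 1 - expNeg ((n : ℝ≥0∞) + 1)⁻¹ := by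
    intro n
    rw [one_sub_expNeg]
    refine measure_mono ?_
    rintro h rfl
    simp
  have h2 : Filter.Tendsto (fun n : ℕ => 1 - expNeg ((n : ℝ≥0∞) + 1)⁻¹) Filter.atTop
      (nhds (1 - expNeg 0)) := by
    refine ENNReal.Tendsto.sub tendsto_const_nhds ((continuous_expNeg.tendsto _).comp ?_)
      (.inl ENNReal.one_ne_top)
    have := (Filter.tendsto_add_atTop_iff_nat 1).2 ENNReal.tendsto_inv_nat_nhds_zero
    simpa using this
  have h3 : complexGaussian 1 {0} ≤ 0 := by
    simpa using ge_of_tendsto' h2 h1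
  rw [ae_iff]
  simpa using h3

/-! ### The path-loss integral over the plane. -/

/-- For `c ≠ 0` the set is the open disk of radius `(c / u)^(1/α)`; the origin belongs to it because
`0^(-α) = ∞`. -/
lemma volume_setOf_lt_mul_enorm_rpow {α : ℝ} (hα : 0 < α) {c u : ℝ≥0∞} (hc : c ≠ ∞) (hu : u ≠ 0)
    (hu' : u ≠ ∞) :
    volume {z : Plane | u < c * ‖z‖ₑ ^ (-α)} =
      ENNReal.ofReal Real.pi * (c ^ (2 / α) * u ^ (-(2 / α))) := by
  rcases eq_or_ne c 0 with rfl | hc0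
  · simp [ENNReal.zero_rpow_of_pos (by positivity : 0 < 2 / α)]
  have hcu : c / u ≠ ∞ := ENNReal.div_ne_top hc hu
  have hset : {z : Plane | u < c * ‖z‖ₑ ^ (-α)} =
      Metric.ball 0 ((c / u) ^ (1 / α)).toReal := by
    ext z
    have hfin : (c / u) ^ (1 / α) ≠ ∞ := ENNReal.rpow_ne_top_of_nonneg (by positivity) hcu
    have hz : ‖z‖ₑ ^ α ≠ ∞ := ENNReal.rpow_ne_top_of_nonneg hα.le enorm_ne_top
    rw [Set.mem_ofPred_eq, mem_ball_zero_iff, ← toReal_enorm,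
      ENNReal.toReal_lt_toReal enorm_ne_top hfin, ENNReal.rpow_neg, ← div_eq_mul_inv,
      ENNReal.lt_div_iff_mul_lt (.inr hu') (.inl hz), mul_comm,
      ← ENNReal.lt_div_iff_mul_lt (.inl hu) (.inl hu'), one_div, ENNReal.lt_rpow_inv_iff hα]
  rw [hset, EuclideanSpace.volume_ball_fin_two, ENNReal.ofReal_toReal
    (ENNReal.rpow_ne_top_of_nonneg (by positivity) hcu), ← ENNReal.rpow_natCast,
    ← ENNReal.rpow_mul, div_eq_mul_inv, ENNReal.mul_rpow_of_nonneg _ _ (by positivity),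
    ENNReal.inv_rpow, ← ENNReal.rpow_neg, mul_comm]
  have he : 1 / α * ((2 : ℕ) : ℝ) = 2 / α := by push_cast; ring
  rw [he, ← NNReal.coe_real_pi, ENNReal.ofReal_coe_nnreal]

/-- With an auxiliary Gaussian `h`, independent of the model, this is the mean area of a disk of
squared radius `(c / |h|²)^(2/α)`. The moment `E[(|h|²)^(-2/α)]` is `Γ(1 - 2/α)`, which requires `α
> 2`. -/
lemma lintegral_one_sub_expNeg_mul_enorm_rpow {α : ℝ} (hα : 2 < α) {c : ℝ≥0∞} (hc : c ≠ ∞) :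
    ∫⁻ z : Plane, (1 - expNeg (c * ‖z‖ₑ ^ (-α))) =
      ENNReal.ofReal (Real.pi * Real.Gamma (1 - 2 / α)) * c ^ (2 / α) := by
  have hα0 : 0 < α := by linarith
  have ha : 2 / α < 1 := (div_lt_one hα0).2 hα
  have hS : MeasurableSet {p : Plane × ℂ | ‖p.2‖ₑ ^ 2 < c * ‖p.1‖ₑ ^ (-α)} :=
    measurableSet_lt (by fun_prop) (by fun_prop)
  simp_rw [one_sub_expNeg]
  calc ∫⁻ z : Plane, complexGaussian 1 {h | ‖h‖ₑ ^ 2 < c * ‖z‖ₑ ^ (-α)}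
      = ((volume : Measure Plane).prod (complexGaussian 1))
          {p : Plane × ℂ | ‖p.2‖ₑ ^ 2 < c * ‖p.1‖ₑ ^ (-α)} := (Measure.prod_apply hS).symm
    _ = ∫⁻ h, volume {z : Plane | ‖h‖ₑ ^ 2 < c * ‖z‖ₑ ^ (-α)} ∂(complexGaussian 1) :=
        Measure.prod_apply_symm hS
    _ = ∫⁻ h, ENNReal.ofReal Real.pi * c ^ (2 / α) * (‖h‖ₑ ^ 2) ^ (-(2 / α))
          ∂(complexGaussian 1) := by
        refine lintegral_congr_ae ?_
        filter_upwards [complexGaussian_ae_ne_zero] with h hh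
        rw [volume_setOf_lt_mul_enorm_rpow hα0 hc (by simpa using hh) (by finiteness), mul_assoc]
    _ = _ := by
        rw [lintegral_const_mul _ (by fun_prop), lintegral_complexGaussian_rpow (by linarith),
          ENNReal.ofReal_mul Real.pi_pos.le, mul_right_comm, ← sub_eq_add_neg]

/-- Euler's reflection formula in terms of `sinc`. -/
lemma Gamma_one_sub_mul_Gamma_one_add {a : ℝ} (h0 : 0 < a) :
    Real.Gamma (1 - a) * Real.Gamma (1 + a) = (Real.sinc (Real.pi * a))⁻¹ := by
  rw [add_comm 1 a, Real.Gamma_add_one h0.ne', Real.sinc_of_ne_zero (by positivity),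
    mul_left_comm, mul_comm (Real.Gamma (1 - a)), Real.Gamma_mul_Gamma_one_sub, inv_div]
  ring

/-- The integral over the plane of `1 - E[exp (-c |h|² ‖z‖^(-α))]` under Rayleigh fading `h`. -/
lemma lintegral_lintegral_one_sub_expNeg {α : ℝ} (hα : 2 < α) {c : ℝ≥0∞} (hc : c ≠ ∞) :
    ∫⁻ h, (∫⁻ z : Plane, (1 - expNeg (c * ‖h‖ₑ ^ 2 * ‖z‖ₑ ^ (-α)))) ∂(complexGaussian 1) =
      ENNReal.ofReal (Real.pi / Real.sinc (Real.pi * (2 / α))) * c ^ (2 / α) := by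
  have hα0 : 0 < α := by linarith
  have ha : 2 / α < 1 := (div_lt_one hα0).2 hα
  have ha0 : 0 < 2 / α := by positivity
  have hG : 0 < Real.Gamma (1 - 2 / α) := Real.Gamma_pos_of_pos (by linarith)
  have h1 : ∀ h : ℂ, ∫⁻ z : Plane, (1 - expNeg (c * ‖h‖ₑ ^ 2 * ‖z‖ₑ ^ (-α))) =
      ENNReal.ofReal (Real.pi * Real.Gamma (1 - 2 / α)) * c ^ (2 / α) * (‖h‖ₑ ^ 2) ^ (2 / α) := by
    intro h
    rw [lintegral_one_sub_expNeg_mul_enorm_rpow hα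
      (ENNReal.mul_ne_top hc (by finiteness)), ENNReal.mul_rpow_of_nonneg _ _ ha0.le, mul_assoc]
  simp_rw [h1]
  rw [lintegral_const_mul _ (by fun_prop), lintegral_complexGaussian_rpow (by linarith),
    mul_right_comm, ← ENNReal.ofReal_mul (by positivity), mul_assoc,
    Gamma_one_sub_mul_Gamma_one_add ha0, ← div_eq_mul_inv]

/-! ### Independence and measurability with respect to groups of sources. -/

/-- Independent variables can be integrated one after the other. -/
lemma lintegral_comp_prod_of_indepFun {Ω A B : Type*} [MeasurableSpace Ω] [MeasurableSpace A]
    [MeasurableSpace B] {μ : Measure Ω} [IsProbabilityMeasure μ] {U : Ω → A} {V : Ω → B}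
    (h : IndepFun U V μ) (hU : Measurable U) (hV : Measurable V) {F : A × B → ℝ≥0∞}
    (hF : Measurable F) :
    ∫⁻ ω, F (U ω, V ω) ∂μ = ∫⁻ ω, ∫⁻ ω', F (U ω, V ω') ∂μ ∂μ := by
  have hV' : IsProbabilityMeasure (μ.map V) := Measure.isProbabilityMeasure_map hV.aemeasurable
  rw [← lintegral_map hF (hU.prodMk hV), (indepFun_iff_map_prod_eq_prod_map_map hU.aemeasurable
    hV.aemeasurable).1 h, lintegral_prod _ hF.aemeasurable, lintegral_map
    hF.lintegral_prod_right' hU]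
  refine lintegral_congr fun ω => ?_
  rw [lintegral_map (by fun_prop) hV]

@[fun_prop] lemma measurable_received (α : ℝ) :
    Measurable fun q : (ℝ × ℂ) × Plane => Network.received α q.1.1 q.1.2 q.2 := by
  unfold Network.received
  fun_prop

namespace Network

variable {Ω : Type*}

lemma measurable_X [MeasurableSpace Ω] {N : Network Ω} (α : ℝ) (hu : Measurable N.user)
    (hp : Measurable N.userPower) : Measurable (N.X α) := by
  unfold X
  fun_prop

lemma measurable_interference [MeasurableSpace Ω] {N : Network Ω} (α : ℝ)
    (hx : ∀ k, Measurable (N.tx k)) (hp : ∀ k, Measurable (N.txPower k))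
    (hh : ∀ k, Measurable (N.txFading k)) : Measurable (N.interference α) :=
  Measurable.tsum fun k => (measurable_received α).comp (((hp k).prodMk (hh k)).prodMk (hx k))

/-- The σ-algebra generated by a set of sources. -/
@[reducible] def sigmaSup (N : Network Ω) (S : Set Source) : MeasurableSpace Ω :=
  ⨆ i ∈ S, N.sigma i

section Sources

variable {N : Network Ω} {S : Set Source}

lemma sigma_le_sigmaSup {i : Source} (hi : i ∈ S) : N.sigma i ≤ N.sigmaSup S :=
  le_iSup₂ (f := fun i (_ : i ∈ S) => N.sigma i) i hi

lemma measurable_user_sigmaSup (hi : .user ∈ S) : Measurable[N.sigmaSup S] N.user :=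
  (comap_measurable _).mono (sigma_le_sigmaSup (N := N) hi) le_rfl

lemma measurable_userPower_sigmaSup (hi : .userPower ∈ S) :
    Measurable[N.sigmaSup S] N.userPower :=
  (comap_measurable _).mono (sigma_le_sigmaSup (N := N) hi) le_rfl

lemma measurable_userFading_sigmaSup (hi : .userFading ∈ S) :
    Measurable[N.sigmaSup S] N.userFading :=
  (comap_measurable _).mono (sigma_le_sigmaSup (N := N) hi) le_rfl

lemma measurable_txSeq_sigmaSup (hi : .tx ∈ S) :
    Measurable[N.sigmaSup S] fun ω k => N.tx k ω :=
  (comap_measurable _).mono (sigma_le_sigmaSup (N := N) hi) le_rfl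

lemma measurable_txPower_sigmaSup {k : ℕ} (hi : .txPower k ∈ S) :
    Measurable[N.sigmaSup S] (N.txPower k) :=
  (comap_measurable _).mono (sigma_le_sigmaSup (N := N) hi) le_rfl

lemma measurable_txFading_sigmaSup {k : ℕ} (hi : .txFading k ∈ S) :
    Measurable[N.sigmaSup S] (N.txFading k) :=
  (comap_measurable _).mono (sigma_le_sigmaSup (N := N) hi) le_rfl

/-- The generated σ-algebra is passed as the ambient one, so the ordinary measurability proof
applies. -/
lemma measurable_X_sigmaSup (α : ℝ) (hu : .user ∈ S) (hp : .userPower ∈ S) :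
    Measurable[N.sigmaSup S] (N.X α) :=
  @measurable_X _ (N.sigmaSup S) N α (measurable_user_sigmaSup hu)
    (measurable_userPower_sigmaSup hp)

lemma measurable_interference_sigmaSup (α : ℝ) (hx : .tx ∈ S) (hp : ∀ k, .txPower k ∈ S)
    (hh : ∀ k, .txFading k ∈ S) : Measurable[N.sigmaSup S] (N.interference α) :=
  @measurable_interference _ (N.sigmaSup S) N α
    (fun k => (measurable_pi_apply k).comp (measurable_txSeq_sigmaSup hx))
    (fun k => measurable_txPower_sigmaSup (hp k)) (fun k => measurable_txFading_sigmaSup (hh k))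

end Sources

variable [MeasurableSpace Ω] {N : Network Ω} {R lam : ℝ} {μ : Measure Ω}

lemma IsModel.sigma_le (hN : N.IsModel R lam μ) (i : Source) : N.sigma i ≤ ‹MeasurableSpace Ω› := by
  cases i with
  | user => exact hN.measurable_user.comap_le
  | userPower => exact hN.measurable_userPower.comap_le
  | userFading => exact hN.measurable_userFading.comap_le
  | tx => exact (measurable_pi_lambda _ hN.measurable_tx).comap_le
  | txPower k => exact (hN.measurable_txPower k).comap_le
  | txFading k => exact (hN.measurable_txFading k).comap_le

lemma IsModel.sigmaSup_le (hN : N.IsModel R lam μ) (S : Set Source) :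
    N.sigmaSup S ≤ ‹MeasurableSpace Ω› :=
  iSup₂_le fun i _ => hN.sigma_le i

lemma IsModel.indep_sigmaSup (hN : N.IsModel R lam μ) {S T : Set Source} (h : Disjoint S T) :
    Indep (N.sigmaSup S) (N.sigmaSup T) μ :=
  indep_iSup_of_disjoint hN.sigma_le hN.indep h

/-- Every independence between random variables used below is obtained by naming disjoint sets of
sources that determine them. -/
lemma IsModel.indepFun {A B : Type*} [MeasurableSpace A] [MeasurableSpace B]
    (hN : N.IsModel R lam μ) {S T : Set Source} (h : Disjoint S T) {U : Ω → A} {V : Ω → B}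
    (hU : Measurable[N.sigmaSup S] U) (hV : Measurable[N.sigmaSup T] V) : IndepFun U V μ :=
  (IndepFun_iff_Indep _ _ _).2 (indep_of_indep_of_le_left
    (indep_of_indep_of_le_right (hN.indep_sigmaSup h) hV.comap_le) hU.comap_le)

/-! ### The Laplace transform of the interference. -/

/-- The joint law of the transmit power and the fading coefficient of a D2D transmitter. -/
def markLaw (N : Network Ω) (μ : Measure Ω) : Measure (ℝ × ℂ) :=
  (μ.map (N.txPower 0)).prod (complexGaussian 1)

variable [IsProbabilityMeasure μ]

lemma IsModel.isProbabilityMeasure_markLaw (hN : N.IsModel R lam μ) :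
    IsProbabilityMeasure (N.markLaw μ) := by
  have := Measure.isProbabilityMeasure_map (μ := μ) (hN.measurable_txPower 0).aemeasurable
  unfold markLaw
  infer_instance

lemma IsModel.map_mark (hN : N.IsModel R lam μ) (k : ℕ) :
    μ.map (fun ω => (N.txPower k ω, N.txFading k ω)) = N.markLaw μ := by
  have h : IndepFun (N.txPower k) (N.txFading k) μ :=
    hN.indepFun (S := {.txPower k}) (T := {.txFading k}) (by simp)
      (measurable_txPower_sigmaSup rfl) (measurable_txFading_sigmaSup rfl)
  rw [(indepFun_iff_map_prod_eq_prod_map_map (hN.measurable_txPower k).aemeasurable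
    (hN.measurable_txFading k).aemeasurable).1 h, hN.txFading_law,
    (hN.txPower_identDistrib k).map_eq, markLaw]

lemma IsModel.lintegral_prod_range (hN : N.IsModel R lam μ) {F : ℕ → ℝ × ℂ → ℝ≥0∞}
    (hF : ∀ k, Measurable (F k)) (n : ℕ) :
    ∫⁻ ω, ∏ k ∈ Finset.range n, F k (N.txPower k ω, N.txFading k ω) ∂μ =
      ∏ k ∈ Finset.range n, ∫⁻ q, F k q ∂(N.markLaw μ) := by
  induction n with
  | zero => simp
  | succ n ih =>
    -- The first `n` factors depend only on `S`, the new one only on `T`.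
    let S : Set Source := {i | ∃ k < n, i = .txPower k ∨ i = .txFading k}
    let T : Set Source := {.txPower n, .txFading n}
    have hST : Disjoint S T := by
      rw [Set.disjoint_left]
      rintro i ⟨k, hk, rfl | rfl⟩ (h | h) <;> cases h <;> exact hk.false
    simp_rw [Finset.prod_range_succ]
    rw [lintegral_mul_eq_lintegral_mul_lintegral_of_independent_measurableSpace
      (hN.sigmaSup_le S) (hN.sigmaSup_le T) (hN.indep_sigmaSup hST), ih]
    · rw [← hN.map_mark n, lintegral_map (hF n)
        ((hN.measurable_txPower n).prodMk (hN.measurable_txFading n))]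
    · refine Finset.measurable_fun_prod _ fun k hk => (hF k).comp ?_
      have hk := Finset.mem_range.1 hk
      exact Measurable.prodMk (measurable_txPower_sigmaSup ⟨k, hk, .inl rfl⟩)
        (measurable_txFading_sigmaSup ⟨k, hk, .inr rfl⟩)
    · exact (hF n).comp (Measurable.prodMk (measurable_txPower_sigmaSup (.inl rfl))
        (measurable_txFading_sigmaSup (.inr rfl)))

/-- The Laplace transform of a single received power, as a function of the location. -/
def receivedLaplace (N : Network Ω) (α : ℝ) (μ : Measure Ω) (s : ℝ≥0∞) (z : Plane) : ℝ≥0∞ :=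
  ∫⁻ q, expNeg (s * received α q.1 q.2 z) ∂(N.markLaw μ)

lemma IsModel.measurable_receivedLaplace (hN : N.IsModel R lam μ) (α : ℝ) (s : ℝ≥0∞) :
    Measurable (N.receivedLaplace α μ s) := by
  have := hN.isProbabilityMeasure_markLaw
  exact Measurable.lintegral_prod_left'
    (f := fun q : (ℝ × ℂ) × Plane => expNeg (s * received α q.1.1 q.1.2 q.2)) (by fun_prop)

lemma IsModel.receivedLaplace_le_one (hN : N.IsModel R lam μ) (α : ℝ) (s : ℝ≥0∞) (z : Plane) :
    N.receivedLaplace α μ s z ≤ 1 := by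
  have := hN.isProbabilityMeasure_markLaw
  calc N.receivedLaplace α μ s z ≤ ∫⁻ _, 1 ∂(N.markLaw μ) :=
        lintegral_mono fun _ => expNeg_le_one _
    _ = 1 := by simp

/-- The Laplace transform of the interference, given the locations of the transmitters. -/
lemma IsModel.lintegral_expNeg_tsum_marks (hN : N.IsModel R lam μ) (α : ℝ) (s : ℝ≥0∞)
    (x : ℕ → Plane) :
    ∫⁻ ω, expNeg (s * ∑' k, received α (N.txPower k ω) (N.txFading k ω) (x k)) ∂μ =
      expNeg (∑' k, negLog (N.receivedLaplace α μ s (x k))) := by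
  have hr : ∀ k, Measurable fun ω => received α (N.txPower k ω) (N.txFading k ω) (x k) :=
    fun k => (measurable_received α).comp
      (((hN.measurable_txPower k).prodMk (hN.measurable_txFading k)).prodMk measurable_const)
  have hfin : ∀ n, ∫⁻ ω, expNeg (∑ k ∈ Finset.range n,
      s * received α (N.txPower k ω) (N.txFading k ω) (x k)) ∂μ =
      expNeg (∑ k ∈ Finset.range n, negLog (N.receivedLaplace α μ s (x k))) := by
    intro n
    simp_rw [expNeg_sum, expNeg_negLog (hN.receivedLaplace_le_one α s _)]
    exact hN.lintegral_prod_range (F := fun k q => expNeg (s * received α q.1 q.2 (x k)))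
      (fun k => measurable_expNeg.comp (((measurable_received α).comp
        (measurable_id.prodMk measurable_const)).const_mul s)) n
  have hleft : Filter.Tendsto (fun n => ∫⁻ ω, expNeg (∑ k ∈ Finset.range n,
      s * received α (N.txPower k ω) (N.txFading k ω) (x k)) ∂μ) Filter.atTop
      (nhds (∫⁻ ω, expNeg (∑' k, s * received α (N.txPower k ω) (N.txFading k ω) (x k)) ∂μ)) := by
    refine tendsto_lintegral_of_dominated_convergence (fun _ => 1) (fun n => ?_)
      (fun n => ae_of_all _ fun ω => expNeg_le_one _) (by simp) (ae_of_all _ fun ω => ?_)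
    · exact measurable_expNeg.comp
        (Finset.measurable_fun_sum _ fun k _ => (hr k).const_mul s)
    · exact (continuous_expNeg.tendsto _).comp ENNReal.summable.hasSum.tendsto_sum_nat
  have hright := (continuous_expNeg.tendsto _).comp (ENNReal.summable (f := fun k =>
    negLog (N.receivedLaplace α μ s (x k)))).hasSum.tendsto_sum_nat
  simp_rw [← ENNReal.tsum_mul_left]
  simp only [hfin] at hleft
  exact tendsto_nhds_unique hleft hright

/-- By Tonelli the location is integrated first, with the mark fixed; the fading then yields the
`sinc` factor, and `p^(2/α)` is left to average. -/
lemma IsModel.lintegral_one_sub_receivedLaplace (hN : N.IsModel R lam μ) {α : ℝ} (hα : 2 < α)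
    {s : ℝ≥0∞} (hs : s ≠ ∞) :
    ∫⁻ z, (1 - N.receivedLaplace α μ s z) =
      ENNReal.ofReal (Real.pi / Real.sinc (Real.pi * (2 / α))) * s ^ (2 / α) *
        ∫⁻ ω, ENNReal.ofReal (N.txPower 0 ω) ^ (2 / α) ∂μ := by
  have := hN.isProbabilityMeasure_markLaw
  have ha0 : 0 ≤ 2 / α := div_nonneg zero_le_two (by linarith)
  have hsub : ∀ z, 1 - N.receivedLaplace α μ s z =
      ∫⁻ q, (1 - expNeg (s * received α q.1 q.2 z)) ∂(N.markLaw μ) := by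
    intro z
    rw [lintegral_sub]
    · simp [receivedLaplace]
    · exact measurable_expNeg.comp (((measurable_received α).comp
        (measurable_id.prodMk measurable_const)).const_mul s)
    · exact ((hN.receivedLaplace_le_one α s z).trans_lt ENNReal.one_lt_top).ne
    · exact ae_of_all _ fun _ => expNeg_le_one _
  simp_rw [hsub]
  rw [lintegral_lintegral_swap, markLaw, lintegral_prod]
  · have hin : ∀ p : ℝ, ∫⁻ h : ℂ, (∫⁻ z : Plane, (1 - expNeg (s * received α p h z)))
        ∂(complexGaussian 1) = ENNReal.ofReal (Real.pi / Real.sinc (Real.pi * (2 / α))) *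
          s ^ (2 / α) * ENNReal.ofReal p ^ (2 / α) := by
      intro p
      have := lintegral_lintegral_one_sub_expNeg hα (ENNReal.mul_ne_top hs
        (ENNReal.ofReal_ne_top (r := p)))
      rw [ENNReal.mul_rpow_of_nonneg _ _ ha0, ← mul_assoc] at this
      simpa only [received, mul_assoc] using this
    simp only [hin]
    rw [lintegral_map (by fun_prop) (hN.measurable_txPower 0), lintegral_const_mul]
    have := hN.measurable_txPower 0
    fun_prop
  · refine (Measurable.lintegral_prod_right'
      (f := fun q : (ℝ × ℂ) × Plane => 1 - expNeg (s * received α q.1.1 q.1.2 q.2)) ?_).aemeasurable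
    fun_prop
  · have h := measurable_received α
    have h2 : Measurable fun q : Plane × (ℝ × ℂ) => received α q.2.1 q.2.2 q.1 :=
      h.comp measurable_swap
    exact (measurable_const.sub (measurable_expNeg.comp (h2.const_mul s))).aemeasurable

/-- The Laplace transform of the interference. -/
theorem IsModel.lintegral_expNeg_mul_interference (hN : N.IsModel R lam μ) {α : ℝ} (hα : 2 < α)
    {s : ℝ≥0∞} (hs : s ≠ ∞) :
    ∫⁻ ω, expNeg (s * N.interference α ω) ∂μ =
      expNeg (ENNReal.ofReal lam * (ENNReal.ofReal (Real.pi / Real.sinc (Real.pi * (2 / α))) *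
        s ^ (2 / α) * ∫⁻ ω, ENNReal.ofReal (N.txPower 0 ω) ^ (2 / α) ∂μ)) := by
  let S : Set Source := {.tx}
  let T : Set Source := {i | ∃ k, i = .txPower k ∨ i = .txFading k}
  have hST : Disjoint S T := by
    rw [Set.disjoint_left]
    rintro i rfl ⟨k, h | h⟩ <;> cases h
  let U : Ω → ℕ → Plane := fun ω k => N.tx k ω
  let V : Ω → ℕ → ℝ × ℂ := fun ω k => (N.txPower k ω, N.txFading k ω)
  have hUV : IndepFun U V μ := hN.indepFun hST (measurable_txSeq_sigmaSup rfl)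
    (@measurable_pi_lambda _ _ _ (N.sigmaSup T) _ _ fun k => Measurable.prodMk
      (measurable_txPower_sigmaSup ⟨k, .inl rfl⟩) (measurable_txFading_sigmaSup ⟨k, .inr rfl⟩))
  have hU : Measurable U := measurable_pi_lambda _ hN.measurable_tx
  have hV : Measurable V := measurable_pi_lambda _ fun k =>
    (hN.measurable_txPower k).prodMk (hN.measurable_txFading k)
  have hF : Measurable fun q : (ℕ → Plane) × (ℕ → ℝ × ℂ) =>
      expNeg (s * ∑' k, received α (q.2 k).1 (q.2 k).2 (q.1 k)) := by
    refine measurable_expNeg.comp ((Measurable.tsum fun k => ?_).const_mul s)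
    exact (measurable_received α).comp (f := fun q : (ℕ → Plane) × (ℕ → ℝ × ℂ) => (q.2 k, q.1 k))
      (by fun_prop)
  -- Freeze the locations and average over the marks.
  have h1 := lintegral_comp_prod_of_indepFun hUV hU hV hF
  simp only [U, V, hN.lintegral_expNeg_tsum_marks] at h1
  have hf : Measurable fun z => negLog (N.receivedLaplace α μ s z) :=
    measurable_negLog.comp (hN.measurable_receivedLaplace α s)
  -- `ENNReal.ofReal lam` is the coercion of `lam.toNNReal`, and a finite multiple keeps
  -- σ-finiteness.
  have hσ : SigmaFinite (ENNReal.ofReal lam • (volume : Measure Plane)) :=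
    inferInstanceAs (SigmaFinite (lam.toNNReal • (volume : Measure Plane)))
  rw [hN.tx_poisson.lintegral_expNeg_tsum hN.measurable_tx hf] at h1
  simp only [expNeg_negLog (hN.receivedLaplace_le_one α s _), lintegral_smul_measure, smul_eq_mul,
    hN.lintegral_one_sub_receivedLaplace hα hs] at h1
  exact h1

end Network

/-! ### The laws of the user's distance and of `X`. -/

lemma measurable_expTerm (α a₁ a₂ : ℝ) : Measurable (expTerm α a₁ a₂) := by
  unfold expTerm
  exact Measurable.ite (measurableSet_singleton _) measurable_const (by fun_prop)

lemma expTerm_nonneg (α a₁ a₂ : ℝ) (x : ℝ≥0∞) : 0 ≤ expTerm α a₁ a₂ x := by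
  unfold expTerm
  split_ifs <;> positivity

lemma ofReal_expTerm {α a₁ a₂ : ℝ} (h₁ : 0 ≤ a₁) (h₂ : 0 ≤ a₂) {x : ℝ≥0∞} (hx : x ≠ ∞) :
    ENNReal.ofReal (expTerm α a₁ a₂ x) =
      expNeg (ENNReal.ofReal a₁ * x + ENNReal.ofReal (a₂ * x.toReal ^ (2 / α))) := by
  have hx' : ENNReal.ofReal x.toReal = x := ENNReal.ofReal_toReal hx
  rw [expTerm, if_neg hx]
  nth_rewrite 3 [← hx']
  rw [← ENNReal.ofReal_mul h₁, ← ENNReal.ofReal_add (by positivity) (by positivity),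
    expNeg_ofReal (by positivity)]
  congr 2
  ring

lemma measurable_distanceCDF (R : ℝ) : Measurable (distanceCDF R) := by
  unfold distanceCDF
  exact Measurable.ite measurableSet_Iio measurable_const
    (Measurable.ite measurableSet_Iic (by fun_prop) measurable_const)

lemma distanceCDF_nonneg (R r : ℝ) : 0 ≤ distanceCDF R r := by
  unfold distanceCDF
  split_ifs <;> positivity

namespace Network

variable {Ω : Type*} [MeasurableSpace Ω] {N : Network Ω} {R lam : ℝ} {μ : Measure Ω}

lemma IsModel.measure_norm_user_le (hN : N.IsModel R lam μ) (hR : 0 < R) (r : ℝ) :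
    μ {ω | ‖N.user ω‖ ≤ r} = ENNReal.ofReal (distanceCDF R r) := by
  have hset : {ω | ‖N.user ω‖ ≤ r} = N.user ⁻¹' Metric.closedBall 0 r := by
    ext ω; simp
  have hvol : ∀ r : ℝ, 0 ≤ r → volume (Metric.closedBall (0 : Plane) r) =
      ENNReal.ofReal (r ^ 2 * Real.pi) := by
    intro r hr
    rw [EuclideanSpace.volume_closedBall_fin_two, ENNReal.ofReal_mul (by positivity),
      ENNReal.ofReal_pow hr, ← NNReal.coe_real_pi, ENNReal.ofReal_coe_nnreal]
  have hpos : 0 < R ^ 2 * Real.pi := by have := Real.pi_pos; positivity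
  rw [hset, ← Measure.map_apply hN.measurable_user Metric.isClosed_closedBall.measurableSet,
    show μ.map N.user = _ from hN.user_uniform,
    cond_apply Metric.isClosed_closedBall.measurableSet, hvol R hR.le, distanceCDF]
  split_ifs with h1 h2
  · simp [Metric.closedBall_eq_empty.2 h1]
  · rw [Set.inter_eq_right.2 (Metric.closedBall_subset_closedBall h2), hvol r (not_lt.1 h1),
      ← ENNReal.ofReal_inv_of_pos hpos, ← ENNReal.ofReal_mul (by positivity)]
    congr 1
    have := Real.pi_ne_zero
    field_simp
  · rw [Set.inter_eq_left.2 (Metric.closedBall_subset_closedBall (not_le.1 h2).le), hvol R hR.le,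
      ENNReal.inv_mul_cancel (by simpa using hpos) ENNReal.ofReal_ne_top, ENNReal.ofReal_one]

lemma IsModel.ae_user_ne_zero (hN : N.IsModel R lam μ) (hR : 0 < R) : ∀ᵐ ω ∂μ, N.user ω ≠ 0 := by
  have h := hN.measure_norm_user_le hR 0
  rw [ae_iff]
  simpa [distanceCDF, hR.le] using h

lemma IsModel.ae_userFading_ne_zero (hN : N.IsModel R lam μ) : ∀ᵐ ω ∂μ, N.userFading ω ≠ 0 := by
  have h := complexGaussian_ae_ne_zero
  rw [← hN.userFading_law] at h
  exact ae_of_ae_map hN.measurable_userFading.aemeasurable h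

variable [IsProbabilityMeasure μ]

/-- The distribution function of the distance of the cellular user. -/
theorem IsModel.cdf_norm_user (hN : N.IsModel R lam μ) (hR : 0 < R) (r : ℝ) :
    cdf (μ.map fun ω => ‖N.user ω‖) r = distanceCDF R r := by
  have hm : Measurable fun ω => ‖N.user ω‖ := hN.measurable_user.norm
  have := Measure.isProbabilityMeasure_map (μ := μ) hm.aemeasurable
  rw [cdf_eq_real, measureReal_def, Measure.map_apply hm measurableSet_Iic]
  change (μ {ω | ‖N.user ω‖ ≤ r}).toReal = _
  rw [hN.measure_norm_user_le hR, ENNReal.toReal_ofReal (distanceCDF_nonneg R r)]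

/-- The distribution function of `X`. -/
theorem IsModel.measureReal_X_le (hN : N.IsModel R lam μ) (hR : 0 < R) {α : ℝ} (hα : 0 < α)
    {x : ℝ} (hx : 0 ≤ x) :
    μ.real {ω | N.X α ω ≤ ENNReal.ofReal x} =
      ∫ p, distanceCDF R (x ^ (1 / α) * p ^ (1 / α)) ∂(μ.map N.userPower) := by
  have hu := hN.measurable_user
  have hp := hN.measurable_userPower
  have hind : IndepFun N.userPower N.user μ :=
    hN.indepFun (S := {.userPower}) (T := {.user}) (by simp)
      (measurable_userPower_sigmaSup rfl) (measurable_user_sigmaSup rfl)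
  have hm : Measurable fun p : ℝ => distanceCDF R (x ^ (1 / α) * p ^ (1 / α)) :=
    (measurable_distanceCDF R).comp (by fun_prop)
  let A : Set (ℝ × Plane) := {q | (ENNReal.ofReal q.1)⁻¹ * ‖q.2‖ₑ ^ α ≤ ENNReal.ofReal x}
  have hA : MeasurableSet A := measurableSet_le (by fun_prop) measurable_const
  have hAm : Measurable (A.indicator (1 : ℝ × Plane → ℝ≥0∞)) := measurable_one.indicator hA
  have hX : MeasurableSet {ω | N.X α ω ≤ ENNReal.ofReal x} :=
    measurableSet_le (measurable_X α hu hp) measurable_const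
  have hsec : ∀ p : ℝ, MeasurableSet {ω | (p, N.user ω) ∈ A} := fun p =>
    (measurable_const.prodMk hu) hA
  have h1 : μ {ω | N.X α ω ≤ ENNReal.ofReal x} =
      ∫⁻ ω, μ {ω' | (N.userPower ω, N.user ω') ∈ A} ∂μ := by
    rw [← lintegral_indicator_one hX]
    refine (lintegral_comp_prod_of_indepFun hind hp hu hAm).trans (lintegral_congr fun ω => ?_)
    rw [← lintegral_indicator_one (hsec _)]
    rfl
  have h2 : ∀ᵐ ω ∂μ, μ {ω' | (N.userPower ω, N.user ω') ∈ A} =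
      ENNReal.ofReal (distanceCDF R (x ^ (1 / α) * N.userPower ω ^ (1 / α))) := by
    filter_upwards [hN.userPower_nonneg] with ω hω
    rw [← hN.measure_norm_user_le hR]
    congr 1
    ext ω'
    simp only [A, Set.mem_ofPred_eq]
    -- For a silent user `X = ∞`, except at the origin where `∞ * 0 = 0`; this matches `‖user‖ ≤ 0`
    -- exactly.
    rcases hω.eq_or_lt with h0 | h0
    · have h0' : (0 : ℝ) ^ (1 / α) = 0 := Real.zero_rpow (by positivity)
      rw [← h0, h0', mul_zero, norm_le_zero_iff, ENNReal.ofReal_zero, ENNReal.inv_zero]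
      by_cases hz : N.user ω' = 0
      · simp [hz, ENNReal.zero_rpow_of_pos hα]
      · simp [hz, ENNReal.top_mul, hα]
    · have hP : ENNReal.ofReal (N.userPower ω) ≠ 0 := by simpa using h0
      rw [mul_comm, ← div_eq_mul_inv, ENNReal.div_le_iff hP ENNReal.ofReal_ne_top,
        ← ENNReal.ofReal_mul hx, ← ENNReal.le_rpow_inv_iff hα,
        ENNReal.ofReal_rpow_of_nonneg (by positivity) (by positivity),
        ENNReal.le_ofReal_iff_toReal_le enorm_ne_top (by positivity), toReal_enorm,
        Real.mul_rpow hx hω, one_div]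
  rw [measureReal_def, h1, lintegral_congr_ae h2, integral_map hp.aemeasurable
    hm.aestronglyMeasurable, integral_eq_lintegral_of_nonneg_ae
    (ae_of_all _ fun _ => distanceCDF_nonneg _ _) (hm.comp hp).aestronglyMeasurable]

/-! ### Coverage as a threshold event for the fading gain. -/

/-- The threshold that the fading gain `|h₀₀|²` has to reach for the uplink to be covered, in terms
of `X` and the interference. -/
def threshold (σ β₀ : ℝ) (x i : ℝ≥0∞) : ℝ≥0∞ :=
  -- Without this case, zero interference and zero noise would give `0 * ∞ = 0` and count a silent
  -- user as covered, against `0 / 0 = 0`.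
  if x = ∞ then ∞ else ENNReal.ofReal β₀ * (i + ENNReal.ofReal (σ ^ 2)) * x

lemma measurable_threshold (σ β₀ : ℝ) :
    Measurable fun q : ℝ≥0∞ × ℝ≥0∞ => threshold σ β₀ q.1 q.2 := by
  unfold threshold
  exact Measurable.ite (measurable_fst (measurableSet_singleton _)) measurable_const (by fun_prop)

/-- For positive power the signal is `|h₀₀|² / X`, nonzero and finite, so clearing denominators is
valid even if the interference plus noise is `0` or `∞`. -/
lemma le_sinr_iff {Ω : Type*} {N : Network Ω} {α σ β₀ : ℝ} (hα : 0 < α) (hβ₀ : 0 < β₀)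
    {ω : Ω} (hu : N.user ω ≠ 0) (hh : N.userFading ω ≠ 0) :
    ENNReal.ofReal β₀ ≤ N.sinr α σ ω ↔
      threshold σ β₀ (N.X α ω) (N.interference α ω) ≤ ‖N.userFading ω‖ₑ ^ 2 := by
  have hH : ‖N.userFading ω‖ₑ ^ 2 ≠ ∞ := by finiteness
  have hH0 : ‖N.userFading ω‖ₑ ^ 2 ≠ 0 := by simpa using hh
  have hD : ‖N.user ω‖ₑ ^ α ≠ ∞ := ENNReal.rpow_ne_top_of_nonneg hα.le enorm_ne_top
  have hD0 : ‖N.user ω‖ₑ ^ α ≠ 0 := by simp [ENNReal.rpow_eq_zero_iff, hu]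
  unfold sinr received threshold X
  rw [ENNReal.rpow_neg]
  generalize ‖N.user ω‖ₑ ^ α = D at *
  generalize ‖N.userFading ω‖ₑ ^ 2 = H at *
  generalize N.interference α ω + ENNReal.ofReal (σ ^ 2) = J
  rcases eq_or_ne (ENNReal.ofReal (N.userPower ω)) 0 with hP | hP
  · rw [hP]
    simp [ENNReal.top_mul, hD0, hβ₀, hH]
  · have hP' : ENNReal.ofReal (N.userPower ω) ≠ ∞ := ENNReal.ofReal_ne_top
    generalize ENNReal.ofReal (N.userPower ω) = P at *
    have hX : P⁻¹ * D ≠ ∞ := ENNReal.mul_ne_top (ENNReal.inv_ne_top.2 hP) hD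
    have hX0 : P⁻¹ * D ≠ 0 := mul_ne_zero (ENNReal.inv_ne_zero.2 hP') hD0
    have hS : P * H * D⁻¹ = H / (P⁻¹ * D) := by
      rw [div_eq_mul_inv, ENNReal.mul_inv (.inr hD) (.inr hD0), inv_inv]
      ring
    have hS0 : H / (P⁻¹ * D) ≠ 0 := ENNReal.div_ne_zero.2 ⟨hH0, hX⟩
    have hS' : H / (P⁻¹ * D) ≠ ∞ := ENNReal.div_ne_top hH hX0
    rw [if_neg hX, hS, ENNReal.le_div_iff_mul_le (.inr hS0) (.inr hS'),
      ENNReal.le_div_iff_mul_le (.inl hX0) (.inl hX)]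

/-- Given `X` and the interference, the uplink is covered with probability `e^(-threshold)`. -/
lemma IsModel.measure_le_sinr (hN : N.IsModel R lam μ) (hR : 0 < R) {α σ β₀ : ℝ} (hα : 0 < α)
    (hβ₀ : 0 < β₀) :
    μ {ω | ENNReal.ofReal β₀ ≤ N.sinr α σ ω} =
      ∫⁻ ω, expNeg (threshold σ β₀ (N.X α ω) (N.interference α ω)) ∂μ := by
  have hae : {ω | ENNReal.ofReal β₀ ≤ N.sinr α σ ω} =ᵐ[μ]
      {ω | threshold σ β₀ (N.X α ω) (N.interference α ω) ≤ ‖N.userFading ω‖ₑ ^ 2} := by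
    filter_upwards [hN.ae_user_ne_zero hR, hN.ae_userFading_ne_zero] with ω hu hh
    exact propext (le_sinr_iff hα hβ₀ hu hh)
  -- `X` and the interference use every source except the user's fading.
  let S : Set Source := {.userFading}ᶜ
  let T : ℝ≥0∞ × ℝ≥0∞ → ℝ≥0∞ := fun q => threshold σ β₀ q.1 q.2
  let Y : Ω → ℝ≥0∞ × ℝ≥0∞ := fun ω => (N.X α ω, N.interference α ω)
  have hY : Measurable Y := (measurable_X α hN.measurable_user hN.measurable_userPower).prodMk
    (measurable_interference α hN.measurable_tx hN.measurable_txPower hN.measurable_txFading)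
  have hind : IndepFun Y N.userFading μ :=
    hN.indepFun (S := S) (T := {.userFading}) disjoint_compl_left
      (Measurable.prodMk (measurable_X_sigmaSup α (by simp [S]) (by simp [S]))
        (measurable_interference_sigmaSup α (by simp [S]) (by simp [S]) (by simp [S])))
      (measurable_userFading_sigmaSup rfl)
  let A : Set ((ℝ≥0∞ × ℝ≥0∞) × ℂ) := {q | T q.1 ≤ ‖q.2‖ₑ ^ 2}
  have hA : MeasurableSet A := measurableSet_le
    ((measurable_threshold σ β₀).comp measurable_fst) (by fun_prop)
  have hAm : Measurable (A.indicator (1 : (ℝ≥0∞ × ℝ≥0∞) × ℂ → ℝ≥0∞)) := measurable_one.indicator hA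
  have hB : MeasurableSet {ω | (Y ω, N.userFading ω) ∈ A} :=
    (hY.prodMk hN.measurable_userFading) hA
  rw [measure_congr hae]
  change μ {ω | (Y ω, N.userFading ω) ∈ A} = ∫⁻ ω, expNeg (T (Y ω)) ∂μ
  rw [← lintegral_indicator_one hB]
  refine (lintegral_comp_prod_of_indepFun hind hY hN.measurable_userFading hAm).trans
    (lintegral_congr fun ω => ?_)
  have hC : MeasurableSet {h : ℂ | T (Y ω) ≤ ‖h‖ₑ ^ 2} :=
    measurableSet_le measurable_const (by fun_prop)
  rw [← complexGaussian_tail, ← hN.userFading_law, ← lintegral_indicator_one hC,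
    lintegral_map (measurable_one.indicator hC) hN.measurable_userFading]
  rfl

/-- The uplink coverage probability. -/
theorem IsModel.coverage_eq (hN : N.IsModel R lam μ) (hR : 0 < R) (hlam : 0 < lam) {α σ β₀ : ℝ}
    (hα : 2 < α) (hβ₀ : 0 < β₀) (hmoment : Integrable (fun ω => N.txPower 0 ω ^ (2 / α)) μ) :
    N.coverage α σ μ β₀ =
      ∫ x, expTerm α (σ ^ 2 * β₀)
        (Real.pi * lam * β₀ ^ (2 / α) / Real.sinc (Real.pi * (2 / α)) *
          ∫ ω, N.txPower 0 ω ^ (2 / α) ∂μ) x ∂(μ.map (N.X α)) := by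
  have hα0 : 0 < α := by linarith
  have ha0 : 0 < 2 / α := by positivity
  have ha1 : 2 / α < 1 := (div_lt_one hα0).2 hα
  -- Here `2/α < 1` keeps the argument of the sine in `[0, π]`.
  have hsinc : 0 ≤ Real.sinc (Real.pi * (2 / α)) := by
    have hpi := Real.pi_pos
    rw [Real.sinc_of_ne_zero (by positivity)]
    refine div_nonneg (Real.sin_nonneg_of_nonneg_of_le_pi (by positivity) ?_) (by positivity)
    nlinarith
  have hM0 : 0 ≤ ∫ ω, N.txPower 0 ω ^ (2 / α) ∂μ := by
    refine integral_nonneg_of_ae ?_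
    filter_upwards [hN.txPower_nonneg 0] with ω hω
    exact Real.rpow_nonneg hω _
  have hM : ∫⁻ ω, ENNReal.ofReal (N.txPower 0 ω) ^ (2 / α) ∂μ =
      ENNReal.ofReal (∫ ω, N.txPower 0 ω ^ (2 / α) ∂μ) := by
    rw [ofReal_integral_eq_lintegral_ofReal hmoment]
    · refine lintegral_congr_ae ?_
      filter_upwards [hN.txPower_nonneg 0] with ω hω
      exact ENNReal.ofReal_rpow_of_nonneg hω ha0.le
    · filter_upwards [hN.txPower_nonneg 0] with ω hω
      exact Real.rpow_nonneg hω _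
  set M := ∫ ω, N.txPower 0 ω ^ (2 / α) ∂μ
  set κ := Real.sinc (Real.pi * (2 / α))
  have hX := measurable_X α hN.measurable_user hN.measurable_userPower
  have hI := measurable_interference α hN.measurable_tx hN.measurable_txPower
    hN.measurable_txFading
  have hind : IndepFun (N.X α) (N.interference α) μ :=
    hN.indepFun (S := {.user, .userPower}) (T := {.user, .userPower}ᶜ) disjoint_compl_right
      (measurable_X_sigmaSup α (by simp) (by simp))
      (measurable_interference_sigmaSup α (by simp) (by simp) (by simp))
  have hT := measurable_threshold σ β₀
  -- Given `X = x`, the noise factor splits off and the Laplace transform is taken at `s = β₀ x`.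
  -- Both sides vanish at `x = ∞`.
  have hin : ∀ x : ℝ≥0∞, ∫⁻ ω, expNeg (threshold σ β₀ x (N.interference α ω)) ∂μ =
      ENNReal.ofReal (expTerm α (σ ^ 2 * β₀)
        (Real.pi * lam * β₀ ^ (2 / α) / κ * M) x) := by
    intro x
    by_cases hx : x = ∞
    · simp [threshold, expTerm, hx]
    rw [ofReal_expTerm (by positivity) (by positivity) hx]
    have hs : ENNReal.ofReal β₀ * x ≠ ∞ := ENNReal.mul_ne_top ENNReal.ofReal_ne_top hx
    have h1 : ∀ i : ℝ≥0∞, expNeg (threshold σ β₀ x i) =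
        expNeg (ENNReal.ofReal (σ ^ 2 * β₀) * x) * expNeg (ENNReal.ofReal β₀ * x * i) := by
      intro i
      rw [threshold, if_neg hx, ← expNeg_add, ENNReal.ofReal_mul (sq_nonneg σ)]
      congr 1
      ring
    simp_rw [h1]
    rw [lintegral_const_mul _ (by fun_prop), hN.lintegral_expNeg_mul_interference hα hs, hM,
      expNeg_add]
    congr 2
    have hx' : ENNReal.ofReal x.toReal = x := ENNReal.ofReal_toReal hx
    nth_rewrite 1 [← hx']
    rw [← ENNReal.ofReal_mul hβ₀.le, ENNReal.ofReal_rpow_of_nonneg (by positivity) ha0.le,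
      ← ENNReal.ofReal_mul (by positivity), ← ENNReal.ofReal_mul (by positivity),
      ← ENNReal.ofReal_mul hlam.le, Real.mul_rpow hβ₀.le ENNReal.toReal_nonneg]
    congr 1
    ring
  have hmeas := measurable_expTerm α (σ ^ 2 * β₀) (Real.pi * lam * β₀ ^ (2 / α) / κ * M)
  rw [coverage, measureReal_def, hN.measure_le_sinr hR hα0 hβ₀,
    lintegral_comp_prod_of_indepFun hind hX hI (F := fun q => expNeg (threshold σ β₀ q.1 q.2))
      (by fun_prop), integral_map hX.aemeasurable hmeas.aestronglyMeasurable,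
    integral_eq_lintegral_of_nonneg_ae (ae_of_all _ fun _ => expTerm_nonneg _ _ _ _)
      (hmeas.comp hX).aestronglyMeasurable]
  simp only [hin]

end Network

end D2D

end

theorem theorem1 {Ω : Type*} [MeasurableSpace Ω] (μ : MeasureTheory.Measure Ω)
    [MeasureTheory.IsProbabilityMeasure μ] (N : D2D.Network Ω)
    (R lam α σ β₀ : ℝ) (hR : 0 < R) (hlam : 0 < lam) (hα : 2 < α) (hβ₀ : 0 < β₀)
    (hN : N.IsModel R lam μ)
    (hmoment : MeasureTheory.Integrable (fun ω => N.txPower 0 ω ^ (2 / α)) μ) :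
    N.coverage α σ μ β₀ =
      ∫ x, D2D.expTerm α (σ ^ 2 * β₀)
        (Real.pi * lam * β₀ ^ (2 / α) / Real.sinc (Real.pi * (2 / α)) *
          ∫ ω, N.txPower 0 ω ^ (2 / α) ∂μ) x ∂(μ.map (N.X α)) ∧
    (∀ r : ℝ, ProbabilityTheory.cdf (μ.map fun ω => ‖N.user ω‖) r = D2D.distanceCDF R r) ∧
    ∀ x : ℝ, 0 ≤ x →
      μ.real {ω | N.X α ω ≤ ENNReal.ofReal x} =
        ∫ p, D2D.distanceCDF R (x ^ (1 / α) * p ^ (1 / α)) ∂(μ.map N.userPower) := by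
  exact ⟨hN.coverage_eq hR hlam hα hβ₀ hmoment, hN.cdf_norm_user hR,
    fun _ hx => hN.measureReal_X_le hR (by linarith) hx⟩
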